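/- Let $k\ge 1$ be an integer. A parking preference of length $n\ge 0$ is a sequence $(a_1,\dots,a_n)$ with all $a_i\in\{1,\dots,n\}$. For an integer $j\ge 0$, it is a $j$-Naples parking function if $n$ cars with preferences $a_1,\dots,a_n$, arriving in this order on an empty one-way street with spots $1,\dots,n$, can all park under the following rule: a car parks in its preferred spot if that spot is free; otherwise it checks up to $j$ spots immediately preceding its preferred spot, one at a time in decreasing order (not going below spot $1$), and parks in the first free one; if none of these is free, it parks in the first free spot after its preferred spot, and fails to park if there is none. Let $I_{n,j}$ be the number of ascending (weakly increasing) $j$-Naples parking functions of length $n$, and let $U_{n,j}$ be the number of those whose first entry is $1$; in particular $I_{0,j}=1$ (the empty sequence) and $U_{0,j}=0$. Let $$I_j(x)=\sum_{n\ge 0} I_{n,j}x^n,\qquad U_j(x)=\sum_{n\ge 0}U_{n,j}x^n,$$ and let $C_k=\frac{1}{k+1}\binom{2k}{k}$ be the $k$-th Catalan number. Then, as formal power series, $$I_k(x)=I_{k-1}(x)+C_kx^kI_{k-1}(x)U_k(x)\qquad\text{and}\qquad U_k(x)=U_{k-1}(x)+C_kx^kU_{k-1}(x)U_k(x).$$ 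-/

import Mathlib

/-- The spots that a car with preference `a` checks under the `k`-Naples rule on a street with
spots `1, …, n`, in the order in which they are checked: its preferred spot `a`; then the (up to)
`k` preceding spots `a - 1, a - 2, …, a - k`, as long as they are at least `1`; then the spots
`a + 1, …, n` ahead of `a`. -/
def searchOrder (n k a : ℕ) : List ℕ :=
  a :: (((List.range k).map (fun j => a - (j + 1))).filter (fun s => 1 ≤ s)
    ++ List.range' (a + 1) (n - a))

/-- The cars with the given list of preferences arrive one after the other on a street with spots
`1, …, n` in which the spots in `occ` are already occupied; each one parks in the first unoccupied
spot in its search order. The result is the final set of occupied spots, or `none` if some car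
fails to park. -/
def parkCars (n k : ℕ) : Finset ℕ → List ℕ → Option (Finset ℕ)
  | occ, [] => some occ
  | occ, a :: l =>
    match (searchOrder n k a).find? (fun s => s ∉ occ) with
    | none => none
    | some s => parkCars n k (insert s occ) l

/-- A parking preference of length `n` is a sequence of `n` integers from `{1, …, n}`. -/
def IsParkingPreference (n : ℕ) (a : List ℕ) : Prop :=
  a.length = n ∧ ∀ x ∈ a, 1 ≤ x ∧ x ≤ n

/-- A `k`-Naples parking function of length `n`: a parking preference of length `n` for which all
`n` cars park (on the initially empty street with spots `1, …, n`) under the `k`-Naples rule. -/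
def IsNaplesParkingFunction (n k : ℕ) (a : List ℕ) : Prop :=
  IsParkingPreference n a ∧ (parkCars n k ∅ a).isSome

/-- The set of ascending (weakly increasing) `k`-Naples parking functions of length `n`. -/
def ascendingNaples (n k : ℕ) : Set (List ℕ) :=
  {a | IsNaplesParkingFunction n k a ∧ a.Pairwise (· ≤ ·)}

/-- The set of ascending `k`-Naples parking functions of length `n` whose first entry is `1`
(the empty sequence has no first entry). -/
def ascendingNaplesFromOne (n k : ℕ) : Set (List ℕ) :=
  {a | a ∈ ascendingNaples n k ∧ a.head? = some 1}

/-- There are finitely many ascending `k`-Naples parking functions of length `n`, so that the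
cardinalities below are genuine. -/
theorem ascendingNaples_finite (n k : ℕ) : (ascendingNaples n k).Finite := by
  refine (Set.finite_range (fun f : Fin n → Fin (n + 1) => List.ofFn (fun i => (f i : ℕ)))).subset ?_
  rintro a ⟨⟨⟨hl, ha⟩, -⟩, -⟩
  subst hl
  exact ⟨fun i => ⟨a.get i, Nat.lt_succ_of_le (ha _ (List.get_mem a i)).2⟩, List.ofFn_get a⟩

/-- `I_{n,k}`, the number of ascending `k`-Naples parking functions of length `n`. -/
noncomputable def numAscending (n k : ℕ) : ℕ := (ascendingNaples n k).ncard

/-- `U_{n,k}`, the number of ascending `k`-Naples parking functions of length `n` that start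
with `1`. -/
noncomputable def numAscendingFromOne (n k : ℕ) : ℕ := (ascendingNaplesFromOne n k).ncard

/-- The ordinary generating function `I_k(x) = ∑_{n ≥ 0} I_{n,k} x^n`. -/
noncomputable def genI (k : ℕ) : PowerSeries ℤ := PowerSeries.mk fun n => (numAscending n k : ℤ)

/-- The ordinary generating function `U_k(x) = ∑_{n ≥ 0} U_{n,k} x^n`. -/
noncomputable def genU (k : ℕ) : PowerSeries ℤ :=
  PowerSeries.mk fun n => (numAscendingFromOne n k : ℤ)

/-! Write K for the Catalan series and A_k for its truncation after x^k. Two decompositions give U_k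
= x K I_k (`genU_eq`) and I_k = 1 + A_k U_k (`genI_eq`).

For the first, remove the leading 1 and cut where the rest first exceeds the diagonal. The cars
before the cut fill an initial block with no condition beyond subdiagonality, counted by Catalan
numbers; those after it see a shorter empty street.

For the second, cut a nonempty ascending list at its first entry not above the diagonal. The i
entries before the cut are superdiagonal, again counted by Catalan numbers, and spot 1 can be
reached only if i ≤ k. In that case these cars and the next one fill spots 1 to i + 1, exactly as if
a shortened list had begun with 1.

Since A_k and A_(k-1) differ only by C_k x^k, eliminating A_(k-1) gives both identities. -/

/-! ### Search orders and the parking process -/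

theorem parkCars_cons (n k : ℕ) (occ : Finset ℕ) (a : ℕ) (l : List ℕ) :
    parkCars n k occ (a :: l) =
      ((searchOrder n k a).find? (fun s => s ∉ occ)).bind
        fun s => parkCars n k (insert s occ) l := by
  rw [parkCars]
  cases (searchOrder n k a).find? (fun s => s ∉ occ) <;> rfl

theorem parkCars_append (n k : ℕ) (l₁ l₂ : List ℕ) (occ : Finset ℕ) :
    parkCars n k occ (l₁ ++ l₂) =
      (parkCars n k occ l₁).bind fun S => parkCars n k S l₂ := by
  induction l₁ generalizing occ with
  | nil => simp [parkCars]
  | cons a l ih =>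
    rw [List.cons_append, parkCars_cons, parkCars_cons, Option.bind_assoc]
    simp only [ih]

theorem mem_searchOrder {n k a s : ℕ} :
    s ∈ searchOrder n k a ↔ s = a ∨ (s < a ∧ 1 ≤ s ∧ a ≤ s + k) ∨ (a < s ∧ s ≤ n) := by
  simp only [searchOrder, List.mem_cons, List.mem_append, List.mem_filter, List.mem_map,
    List.mem_range, List.mem_range'_1, decide_eq_true_eq]
  refine or_congr_right (or_congr ⟨?_, ?_⟩ (by omega))
  · rintro ⟨⟨j, hj, rfl⟩, h⟩
    omega
  · rintro ⟨h₁, h₂, h₃⟩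
    exact ⟨⟨a - s - 1, by omega, by omega⟩, h₂⟩

/-- The search order first descends from `a` and then ascends from `a + 1`. -/
theorem pairwise_searchOrder (n k a : ℕ) :
    (searchOrder n k a).Pairwise
      (fun u v => (u ≤ a → v < u ∨ a < v) ∧ (a < u → u < v)) := by
  rw [searchOrder, List.pairwise_cons, List.pairwise_append]
  refine ⟨?_, ?_, ?_, ?_⟩
  · intro v hv
    simp only [List.mem_append, List.mem_filter, List.mem_map, List.mem_range,
      List.mem_range'_1, decide_eq_true_eq] at hv
    rcases hv with ⟨⟨j, hj, rfl⟩, h⟩ | h <;> omega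
  · rw [List.pairwise_filter, List.pairwise_map]
    refine List.pairwise_lt_range.imp ?_
    intro i j hij
    simp only [decide_eq_true_eq]
    omega
  · refine (List.pairwise_lt_range' 1).imp_of_mem ?_
    intro u v hu hv huv
    rw [List.mem_range'_1] at hu hv
    omega
  · intro u hu v hv
    simp only [List.mem_filter, List.mem_map, List.mem_range, decide_eq_true_eq] at hu
    rw [List.mem_range'_1] at hv
    rcases hu with ⟨⟨j, hj, rfl⟩, h⟩
    omega

/-- Being first in the search is turned into linear inequalities against every other free spot
searched, so that later arguments reduce to `omega`. -/
theorem find?_searchOrder_spec {n k a s : ℕ} {occ : Finset ℕ}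
    (h : (searchOrder n k a).find? (fun s => s ∉ occ) = some s) :
    s ∉ occ ∧ s ∈ searchOrder n k a ∧
      ∀ x ∈ searchOrder n k a, x ∉ occ →
        x = s ∨ ((s ≤ a → x < s ∨ a < x) ∧ (a < s → s < x)) := by
  obtain ⟨hs, as, bs, heq, has⟩ := List.find?_eq_some_iff_append.1 h
  refine ⟨by simpa using hs, List.mem_of_find?_eq_some h, fun x hx hxo => ?_⟩
  have hp := pairwise_searchOrder n k a
  rw [heq] at hx hp
  rw [List.pairwise_append, List.pairwise_cons] at hp
  rcases List.mem_append.1 hx with hx | hx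
  · exact absurd (has x hx) (by simpa using hxo)
  · rcases List.mem_cons.1 hx with hx | hx
    · exact Or.inl hx
    · exact Or.inr (hp.2.1.1 x hx)

theorem exists_find?_searchOrder {n k a x : ℕ} {occ : Finset ℕ}
    (hx : x ∈ searchOrder n k a) (hxo : x ∉ occ) :
    ∃ s, (searchOrder n k a).find? (fun s => s ∉ occ) = some s := by
  rw [← Option.isSome_iff_exists, List.find?_isSome]
  exact ⟨x, hx, by simpa using hxo⟩

theorem card_of_parkCars {n k : ℕ} {l : List ℕ} {occ S : Finset ℕ}
    (h : parkCars n k occ l = some S) : S.card = occ.card + l.length := by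
  induction l generalizing occ with
  | nil =>
    simp only [parkCars, Option.some.injEq] at h
    simp [h]
  | cons a l ih =>
    rw [parkCars_cons, Option.bind_eq_some_iff] at h
    obtain ⟨s, hs, h⟩ := h
    rw [ih h, Finset.card_insert_of_notMem (find?_searchOrder_spec hs).1, List.length_cons]
    omega

theorem subset_Icc_of_parkCars {n k : ℕ} {l : List ℕ} {occ S : Finset ℕ}
    (hl : ∀ x ∈ l, 1 ≤ x ∧ x ≤ n) (hocc : occ ⊆ Finset.Icc 1 n)
    (h : parkCars n k occ l = some S) : S ⊆ Finset.Icc 1 n := by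
  induction l generalizing occ with
  | nil =>
    simp only [parkCars, Option.some.injEq] at h
    exact h ▸ hocc
  | cons a l ih =>
    rw [parkCars_cons, Option.bind_eq_some_iff] at h
    obtain ⟨s, hs, h⟩ := h
    refine ih (fun x hx => hl x (List.mem_cons_of_mem _ hx)) (Finset.insert_subset ?_ hocc) h
    have h₁ := mem_searchOrder.1 (find?_searchOrder_spec hs).2.1
    have h₂ := hl a List.mem_cons_self
    rw [Finset.mem_Icc]
    omega

/-! ### Filling initial blocks and reaching spot 1 -/

/-- Cars that prefer an occupied spot of an initial block extend this block by one spot each. -/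
theorem parkCars_Icc {n k : ℕ} {l : List ℕ} {m : ℕ} (hn : m + l.length ≤ n)
    (hl : ∀ j x, l[j]? = some x → 1 ≤ x ∧ x ≤ m + j) :
    parkCars n k (Finset.Icc 1 m) l = some (Finset.Icc 1 (m + l.length)) := by
  induction l generalizing m with
  | nil => simp [parkCars]
  | cons a l ih =>
    rw [List.length_cons] at hn
    have ha := hl 0 a rfl
    have hmem : m + 1 ∈ searchOrder n k a := mem_searchOrder.2 (by omega)
    have hfree : m + 1 ∉ Finset.Icc 1 m := by simp
    obtain ⟨s, hs⟩ := exists_find?_searchOrder hmem hfree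
    obtain ⟨h₁, h₂, h₃⟩ := find?_searchOrder_spec hs
    have h₄ := h₃ _ hmem hfree
    rw [mem_searchOrder] at h₂
    rw [Finset.mem_Icc] at h₁
    -- Spots up to `a` lie in the full block, so the car moves forward, and the nearest free spot is
    -- `m + 1`.
    obtain rfl : s = m + 1 := by omega
    rw [parkCars_cons, hs, Option.bind_some,
      show insert (m + 1) (Finset.Icc 1 m) = Finset.Icc 1 (m + 1) by
        ext x; simp only [Finset.mem_insert, Finset.mem_Icc]; omega,
      ih (by omega), List.length_cons, add_assoc, add_comm 1]
    intro j x hx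
    have := hl (j + 1) x (by simpa using hx)
    omega

/-- Cars whose preferences are at most `k + 1` and so large that a spot below is always free. -/
theorem exists_parkCars_of_le {n k t : ℕ} {l : List ℕ} {occ : Finset ℕ} (ht : t ≤ k + 1)
    (hocc : occ ⊆ Finset.Icc 1 t)
    (hl : ∀ j x, l[j]? = some x → occ.card + j + 1 ≤ x ∧ x ≤ t) :
    ∃ S, parkCars n k occ l = some S ∧ S ⊆ Finset.Icc 1 t := by
  induction l generalizing occ with
  | nil => exact ⟨occ, rfl, hocc⟩
  | cons a l ih =>
    have ha := hl 0 a rfl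
    -- Fewer than `a` cars have parked, so some spot up to `a` is free; `a ≤ k + 1` puts it within
    -- backward reach.
    obtain ⟨y, hy, hyo⟩ : ∃ y ∈ Finset.Icc 1 a, y ∉ occ := by
      refine Finset.exists_mem_notMem_of_card_lt_card ?_
      rw [Nat.card_Icc]
      omega
    rw [Finset.mem_Icc] at hy
    have hmem : y ∈ searchOrder n k a := mem_searchOrder.2 (by omega)
    obtain ⟨s, hs⟩ := exists_find?_searchOrder hmem hyo
    obtain ⟨h₁, h₂, h₃⟩ := find?_searchOrder_spec hs
    have h₄ := h₃ _ hmem hyo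
    rw [mem_searchOrder] at h₂
    rw [parkCars_cons, hs, Option.bind_some]
    refine ih (Finset.insert_subset (Finset.mem_Icc.2 (by omega)) hocc) ?_
    intro j x hx
    have := hl (j + 1) x (by simpa using hx)
    rw [Finset.card_insert_of_notMem h₁]
    omega

/-- Spot `1` stays free as long as every preference is larger than `k + 1` or than the number of
cars on the street. -/
theorem one_notMem_of_parkCars {n k : ℕ} {l : List ℕ} {occ S : Finset ℕ} (hocc : 1 ∉ occ)
    (hl : ∀ j x, l[j]? = some x → occ.card + j + 1 < x ∨ k + 1 < x)
    (h : parkCars n k occ l = some S) : 1 ∉ S := by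
  induction l generalizing occ with
  | nil =>
    simp only [parkCars, Option.some.injEq] at h
    exact h ▸ hocc
  | cons a l ih =>
    rw [parkCars_cons, Option.bind_eq_some_iff] at h
    obtain ⟨s, hs, h⟩ := h
    have ha := hl 0 a rfl
    obtain ⟨h₁, h₂, h₃⟩ := find?_searchOrder_spec hs
    rw [mem_searchOrder] at h₂
    have hs₁ : s ≠ 1 := by
      rintro rfl
      -- A car backs into spot 1 only past a full stretch from 2 to `a`, which takes `a - 1` earlier
      -- cars: too many.
      have hsub : Finset.Icc 2 a ⊆ occ := by
        intro x hx
        rw [Finset.mem_Icc] at hx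
        by_contra hxo
        have := h₃ x (mem_searchOrder.2 (by omega)) hxo
        omega
      have := Finset.card_le_card hsub
      rw [Nat.card_Icc] at this
      omega
    refine ih (by simp [hocc, hs₁.symm]) ?_ h
    intro j x hx
    have := hl (j + 1) x (by simpa using hx)
    rw [Finset.card_insert_of_notMem h₁]
    omega

/-! ### Shortening the street by a filled block -/

/-- Discarding spots up to `m` cuts the backward search exactly where the shorter street ends, so
both searches agree up to translation. -/
theorem filter_searchOrder_add (n k m a : ℕ) (ha : 1 ≤ a) :
    (searchOrder (n + m) k (a + m)).filter (fun s => m < s) =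
      (searchOrder n k a).map (· + m) := by
  simp only [searchOrder, List.filter_cons, List.filter_append, List.map_cons, List.map_append,
    List.filter_filter, List.filter_map, List.map_map]
  rw [if_pos (by simp; omega)]
  congr 2
  · rw [List.filter_congr (q := (fun s => decide (1 ≤ s)) ∘ fun j => a - (j + 1))]
    · refine List.map_congr_left fun j hj => ?_
      simp only [List.mem_filter, Function.comp_apply, decide_eq_true_eq] at hj
      simp only [Function.comp_apply]
      omega
    · intro j _
      simp only [Function.comp_apply, ← Bool.decide_and, decide_eq_decide]
      omega
  · rw [List.filter_eq_self.2, show n + m - (a + m) = n - a by omega]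
    · rw [show a + m + 1 = m + (a + 1) by omega, ← List.map_add_range']
      exact List.map_congr_left fun x _ => add_comm _ _
    · intro x hx
      rw [List.mem_range'_1] at hx
      simp only [decide_eq_true_eq]
      omega

/-- Parking on a street whose first `m` spots are taken amounts to parking on a street that is
shorter by `m` spots. -/
theorem isSome_parkCars_add (n k m : ℕ) (l : List ℕ) (hl : ∀ x ∈ l, 1 ≤ x)
    (occ occ' : Finset ℕ) (h : ∀ x, 1 ≤ x → (x + m ∈ occ' ↔ x ∈ occ))
    (h' : ∀ x, 1 ≤ x → x ≤ m → x ∈ occ') :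
    (parkCars (n + m) k occ' (l.map (· + m))).isSome = (parkCars n k occ l).isSome := by
  induction l generalizing occ occ' with
  | nil => rfl
  | cons a l ih =>
    have ha := hl a List.mem_cons_self
    have hpos : ∀ n k b s, 1 ≤ b → s ∈ searchOrder n k b → 1 ≤ s := by
      intro n k b s hb hs
      rw [mem_searchOrder] at hs
      omega
    -- Spots up to `m` are occupied, so filtering them out does not change the result of the search.
    have key : (searchOrder (n + m) k (a + m)).find? (fun s => s ∉ occ') =
        ((searchOrder n k a).find? (fun s => s ∉ occ)).map (· + m) := by
      rw [← List.find?_congr (l := searchOrder n k a) (p₁ := (fun s => s ∉ occ') ∘ (· + m)),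
        ← List.find?_map, ← filter_searchOrder_add n k m a ha, List.find?_filter]
      · refine List.find?_congr fun x hx => ?_
        have := hpos _ _ _ _ (by omega) hx
        by_cases hxm : m < x
        · simp [hxm]
        · simp [hxm, h' x this (by omega)]
      · intro x hx
        simp [h x (hpos _ _ _ _ ha hx)]
    rw [List.map_cons, parkCars_cons, parkCars_cons, key]
    cases (searchOrder n k a).find? (fun s => s ∉ occ) with
    | none => rfl
    | some s =>
      simp only [Option.map_some, Option.bind_some]
      refine ih (fun x hx => hl x (List.mem_cons_of_mem _ hx)) _ _ ?_ ?_
      · intro x hx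
        simp [h x hx]
      · intro x hx hxm
        exact Finset.mem_insert_of_mem (h' x hx hxm)

theorem parkCars_one_cons (n k : ℕ) (l : List ℕ) :
    parkCars n k ∅ (1 :: l) = parkCars n k (Finset.Icc 1 1) l := by
  rw [parkCars_cons]
  simp [searchOrder]

/-! ### Unique splittings of lists -/

theorem finite_setOf_length_eq_and_le (t N : ℕ) :
    {l : List ℕ | l.length = t ∧ ∀ x ∈ l, x ≤ N}.Finite := by
  refine (Set.finite_range
    (fun f : Fin t → Fin (N + 1) => List.ofFn (fun i => (f i : ℕ)))).subset ?_
  rintro a ⟨rfl, ha⟩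
  exact ⟨fun i => ⟨a.get i, Nat.lt_succ_of_le (ha _ (List.get_mem a i))⟩, List.ofFn_get a⟩

/-- Every list splits at the first position where the predicate `T` fails. -/
theorem exists_append_of_pred (b : List ℕ) (T : ℕ → ℕ → Prop) :
    ∃ p r, b = p ++ r ∧ (∀ j x, p[j]? = some x → T j x) ∧
      ∀ y, r[0]? = some y → ¬ T p.length y := by
  induction b generalizing T with
  | nil => exact ⟨[], [], rfl, by simp, by simp⟩
  | cons a l ih =>
    by_cases ha : T 0 a
    · obtain ⟨p, r, rfl, hp, hr⟩ := ih fun j => T (j + 1)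
      refine ⟨a :: p, r, rfl, ?_, hr⟩
      rintro (_ | j) x hx
      · simp only [List.getElem?_cons_zero, Option.some.injEq] at hx
        exact hx ▸ ha
      · exact hp j x (by simpa using hx)
    · refine ⟨[], a :: l, rfl, by simp, ?_⟩
      intro y hy
      simp only [List.getElem?_cons_zero, Option.some.injEq] at hy
      exact hy ▸ ha

theorem exists_eq_map_add (r : List ℕ) (d : ℕ) (hr : ∀ x ∈ r, d + 1 ≤ x) :
    ∃ q : List ℕ, r = q.map (· + d) ∧ ∀ x ∈ q, 1 ≤ x := by
  refine ⟨r.map (· - d), ?_, ?_⟩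
  · rw [List.map_map]
    conv_lhs => rw [← List.map_id r]
    refine List.map_congr_left fun x hx => ?_
    have := hr x hx
    simp only [id, Function.comp_apply]
    omega
  · intro x hx
    obtain ⟨y, hy, rfl⟩ := List.mem_map.1 hx
    have := hr y hy
    omega

/-- Counting lists that split uniquely into a part in `P i` and a shifted part in `Q i`, where
`T` distinguishes the entries of the first part from the first entry of the second. -/
theorem ncard_eq_sum_of_split {A : Set (List ℕ)} {N : ℕ} {P Q : ℕ → Set (List ℕ)} {d : ℕ → ℕ}
    (T : ℕ → ℕ → Prop) (hP : ∀ i, (P i).Finite) (hQ : ∀ i, (Q i).Finite)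
    (hlen : ∀ i, ∀ p ∈ P i, p.length = i)
    (hT : ∀ i, ∀ p ∈ P i, ∀ j x, p[j]? = some x → T j x)
    (hT' : ∀ i, ∀ q ∈ Q i, ∀ y, q[0]? = some y → ¬ T i (y + d i))
    (hmem : ∀ i ≤ N, ∀ p ∈ P i, ∀ q ∈ Q i, p ++ q.map (· + d i) ∈ A)
    (hsplit : ∀ a ∈ A, ∃ i ≤ N, ∃ p ∈ P i, ∃ q ∈ Q i, a = p ++ q.map (· + d i)) :
    A.ncard = ∑ i ∈ Finset.range (N + 1), (P i).ncard * (Q i).ncard := by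
  -- If `i < i'`, the entry at position `i` would both satisfy `T`, lying in `p'`, and violate it,
  -- opening the shifted `q`.
  have hle : ∀ (i i' : ℕ) (p p' q q' : List ℕ), p ∈ P i → p' ∈ P i' → q ∈ Q i →
      p ++ q.map (· + d i) = p' ++ q'.map (· + d i') → i' ≤ i := by
    intro i i' p p' q q' hp hp' hq heq
    by_contra! hlt
    have hlp := hlen i p hp
    have hlp' := hlen i' p' hp'
    obtain ⟨x, hx⟩ : ∃ x, p'[i]? = some x := ⟨_, List.getElem?_eq_getElem (by omega)⟩
    have h := congrArg (fun l => l[i]?) heq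
    simp only [List.getElem?_append, hlp, hlp', lt_irrefl, if_false, hlt, if_true, Nat.sub_self,
      hx, List.getElem?_map, Option.map_eq_some_iff] at h
    obtain ⟨y, hy, rfl⟩ := h
    exact hT' i q hq y hy (hT i' p' hp' i _ hx)
  have hPf : ∀ i, Finite (P i) := fun i => (hP i).to_subtype
  have hQf : ∀ i, Finite (Q i) := fun i => (hQ i).to_subtype
  let f : (Σ i : Fin (N + 1), P i × Q i) → A := fun z =>
    ⟨z.2.1.1 ++ z.2.2.1.map (· + d z.1),
      hmem _ (Nat.lt_succ_iff.1 z.1.2) _ z.2.1.2 _ z.2.2.2⟩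
  have hf : Function.Bijective f := by
    constructor
    · rintro ⟨⟨i, hi⟩, ⟨p, hp⟩, ⟨q, hq⟩⟩ ⟨⟨i', hi'⟩, ⟨p', hp'⟩, ⟨q', hq'⟩⟩ h
      have heq : p ++ q.map (· + d i) = p' ++ q'.map (· + d i') := congrArg Subtype.val h
      obtain rfl : i = i' :=
        le_antisymm (hle _ _ _ _ _ _ hp' hp hq' heq.symm) (hle _ _ _ _ _ _ hp hp' hq heq)
      obtain ⟨rfl, h₂⟩ := List.append_inj heq ((hlen _ _ hp).trans (hlen _ _ hp').symm)
      obtain rfl := List.map_injective_iff.2 (add_left_injective (d i)) h₂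
      rfl
    · rintro ⟨a, ha⟩
      obtain ⟨i, hi, p, hp, q, hq, rfl⟩ := hsplit a ha
      exact ⟨⟨⟨i, Nat.lt_succ_iff.2 hi⟩, ⟨p, hp⟩, ⟨q, hq⟩⟩, rfl⟩
  rw [← Nat.card_coe_set_eq, ← Nat.card_congr (Equiv.ofBijective f hf), Nat.card_sigma,
    Finset.sum_range]
  simp only [Nat.card_prod, Nat.card_coe_set_eq]

theorem ncard_setOf_cons_mem {B : Set (List ℕ)} {c : ℕ} (hB : ∀ a ∈ B, a.head? = some c) :
    {b | c :: b ∈ B}.ncard = B.ncard := by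
  have : B = (List.cons c) '' {b | c :: b ∈ B} := by
    ext a
    constructor
    · intro ha
      have h := hB a ha
      cases a with
      | nil => simp at h
      | cons x l =>
        obtain rfl : x = c := by simpa using h
        exact ⟨l, ha, rfl⟩
    · rintro ⟨b, hb, rfl⟩
      exact hb
  conv_rhs => rw [this]
  rw [Set.ncard_image_of_injective _ List.cons_injective]

/-! ### Lists on either side of the diagonal -/

/-- Ascending lists of length `t` whose entry in position `j` (counted from `0`) lies between `1`
and `j + 1`. -/
def subdiagonalLists (t : ℕ) : Set (List ℕ) :=
  {p | p.length = t ∧ p.Pairwise (· ≤ ·) ∧ ∀ j x, p[j]? = some x → 1 ≤ x ∧ x ≤ j + 1}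

/-- Ascending lists of length `t` whose entry in position `j` (counted from `0`) lies between
`j + 2` and `t + 1`. -/
def superdiagonalLists (t : ℕ) : Set (List ℕ) :=
  {p | p.length = t ∧ p.Pairwise (· ≤ ·) ∧ ∀ j x, p[j]? = some x → j + 2 ≤ x ∧ x ≤ t + 1}

theorem lt_length_of_getElem?_eq_some {l : List ℕ} {j x : ℕ} (h : l[j]? = some x) :
    j < l.length :=
  (List.getElem?_eq_some_iff.1 h).1

theorem le_of_mem_subdiagonalLists {t : ℕ} {p : List ℕ} (hp : p ∈ subdiagonalLists t) :
    ∀ x ∈ p, 1 ≤ x ∧ x ≤ t := by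
  intro x hx
  obtain ⟨j, hj⟩ := List.mem_iff_getElem?.1 hx
  have h₁ := hp.2.2 j x hj
  have h₂ := lt_length_of_getElem?_eq_some hj
  have h₃ := hp.1
  omega

theorem le_of_mem_superdiagonalLists {t : ℕ} {p : List ℕ} (hp : p ∈ superdiagonalLists t) :
    ∀ x ∈ p, 2 ≤ x ∧ x ≤ t + 1 := by
  intro x hx
  obtain ⟨j, hj⟩ := List.mem_iff_getElem?.1 hx
  have h₁ := hp.2.2 j x hj
  omega

theorem subdiagonalLists_finite (t : ℕ) : (subdiagonalLists t).Finite :=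
  (finite_setOf_length_eq_and_le t t).subset fun _ hp =>
    ⟨hp.1, fun x hx => (le_of_mem_subdiagonalLists hp x hx).2⟩

theorem superdiagonalLists_finite (t : ℕ) : (superdiagonalLists t).Finite :=
  (finite_setOf_length_eq_and_le t (t + 1)).subset fun _ hp =>
    ⟨hp.1, fun x hx => (le_of_mem_superdiagonalLists hp x hx).2⟩

/-- Reversing the list and replacing each `x` by `t + 2 - x` exchanges the two sides of the
diagonal. -/
theorem ncard_superdiagonalLists (t : ℕ) :
    (superdiagonalLists t).ncard = (subdiagonalLists t).ncard := by
  have hinv : ∀ p : List ℕ, (∀ x ∈ p, x ≤ t + 2) →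
      ((p.map (t + 2 - ·)).reverse.map (t + 2 - ·)).reverse = p := by
    intro p hp
    rw [List.map_reverse, List.reverse_reverse, List.map_map]
    conv_rhs => rw [← List.map_id p]
    refine List.map_congr_left fun x hx => ?_
    have := hp x hx
    simp only [id, Function.comp_apply]
    omega
  have hpw : ∀ p : List ℕ, p.Pairwise (· ≤ ·) →
      (p.map (t + 2 - ·)).reverse.Pairwise (· ≤ ·) := by
    intro p hp
    rw [List.pairwise_reverse, List.pairwise_map]
    exact hp.imp fun h => Nat.sub_le_sub_left h _
  have hget : ∀ p : List ℕ, p.length = t → ∀ j x, (p.map (t + 2 - ·)).reverse[j]? = some x →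
      j < t ∧ ∃ y, p[t - 1 - j]? = some y ∧ t + 2 - y = x := by
    intro p hp j x hx
    have hj := lt_length_of_getElem?_eq_some hx
    rw [List.length_reverse, List.length_map, hp] at hj
    rw [List.getElem?_reverse (by simpa [hp] using hj), List.length_map, hp, List.getElem?_map,
      Option.map_eq_some_iff] at hx
    exact ⟨hj, hx⟩
  refine Set.ncard_congr (fun p _ => (p.map (t + 2 - ·)).reverse) ?_ ?_ ?_
  · rintro p ⟨hl, hs, hp⟩
    refine ⟨by simpa using hl, hpw p hs, ?_⟩
    intro j x hx
    obtain ⟨hj, y, hy, rfl⟩ := hget p hl j x hx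
    have := hp _ _ hy
    omega
  · intro p q hp hq h
    rw [← hinv p fun x hx => by have := le_of_mem_superdiagonalLists hp x hx; omega,
      ← hinv q fun x hx => by have := le_of_mem_superdiagonalLists hq x hx; omega]
    exact congrArg (fun l => (l.map (t + 2 - ·)).reverse) h
  · intro q hq
    refine ⟨(q.map (t + 2 - ·)).reverse, ⟨by simpa using hq.1, hpw q hq.2.1, ?_⟩,
      hinv q fun x hx => by have := le_of_mem_subdiagonalLists hq x hx; omega⟩
    intro j x hx
    obtain ⟨hj, y, hy, rfl⟩ := hget q hq.1 j x hx
    have := hq.2.2 _ _ hy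
    omega

/-- Shifted entries are at least `d + 1`, so no order condition arises across the seam. -/
theorem pairwise_append_map_add {p q : List ℕ} {d : ℕ} (h : ∀ x ∈ p, x ≤ d + 1)
    (hq : ∀ x ∈ q, 1 ≤ x) :
    (p ++ q.map (· + d)).Pairwise (· ≤ ·) ↔ p.Pairwise (· ≤ ·) ∧ q.Pairwise (· ≤ ·) := by
  rw [List.pairwise_append, List.pairwise_map]
  simp only [add_le_add_iff_right, List.mem_map]
  refine and_congr_right fun _ => and_iff_left ?_
  rintro x hx _ ⟨y, hy, rfl⟩
  have := h x hx
  have := hq y hy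
  omega

/-- An ascending list of positive integers splits at the first position where it exceeds the
diagonal. -/
theorem exists_subdiagonalLists_append {b : List ℕ} (hb : b.Pairwise (· ≤ ·))
    (hpos : ∀ x ∈ b, 1 ≤ x) :
    ∃ i, ∃ p ∈ subdiagonalLists i, ∃ q : List ℕ, (∀ x ∈ q, 1 ≤ x) ∧
      b = p ++ q.map (· + (i + 1)) := by
  obtain ⟨p, r, rfl, hp, hr⟩ := exists_append_of_pred b fun j x => x ≤ j + 1
  rw [List.pairwise_append] at hb
  have hr' : ∀ x ∈ r, p.length + 1 + 1 ≤ x := by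
    cases r with
    | nil => simp
    | cons y r =>
      have hy := hr y rfl
      intro x hx
      rcases List.mem_cons.1 hx with rfl | hx
      · omega
      · have := (List.pairwise_cons.1 hb.2.1).1 x hx
        omega
  obtain ⟨q, rfl, hq⟩ := exists_eq_map_add r _ hr'
  refine ⟨p.length, p, ⟨rfl, hb.1, fun j x hx => ⟨?_, hp j x hx⟩⟩, q, hq, rfl⟩
  exact hpos x (List.mem_append_left _ (List.mem_of_getElem? hx))

/-- A nonempty ascending list of positive integers whose length bounds its entries splits at the
first position where it does not exceed the diagonal. -/
theorem exists_superdiagonalLists_append {a : List ℕ} (ha : a.Pairwise (· ≤ ·))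
    (hpos : ∀ x ∈ a, 1 ≤ x ∧ x ≤ a.length) (hne : a ≠ []) :
    ∃ i, ∃ p ∈ superdiagonalLists i, ∃ q : List ℕ, (∀ x ∈ q, 1 ≤ x) ∧
      a = p ++ (1 :: q).map (· + i) := by
  obtain ⟨p, r, rfl, hp, hr⟩ := exists_append_of_pred a fun j x => j + 2 ≤ x
  rw [List.pairwise_append] at ha
  have hlast : ∀ h : p ≠ [], p.length + 1 ≤ p.getLast h := by
    intro h
    have hlen := List.length_pos_of_ne_nil h
    have := hp (p.length - 1) (p.getLast h) (by
      rw [List.getLast_eq_getElem]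
      exact List.getElem?_eq_getElem _)
    omega
  -- Without a return to the diagonal, the last entry would exceed the length of the list.
  cases r with
  | nil =>
    simp only [List.append_nil] at hne hpos
    have := hlast hne
    have := hpos _ (List.getLast_mem hne)
    omega
  | cons y r =>
    have hy := hr y rfl
    -- The return is exactly on the diagonal: `y` fails to exceed it, yet is at least the last entry
    -- of `p`, or 1 if `p` is empty.
    have hy' : y = 1 + p.length := by
      by_cases h : p = []
      · have := hpos y (by simp)
        simp [h] at hy ⊢
        omega
      · have := hlast h
        have := ha.2.2 _ (List.getLast_mem h) y List.mem_cons_self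
        omega
    obtain ⟨q, rfl, hq⟩ := exists_eq_map_add r p.length fun x hx => by
      have := (List.pairwise_cons.1 ha.2.1).1 x hx
      omega
    refine ⟨p.length, p, ⟨rfl, ha.1, fun j x hx => ⟨hp j x hx, ?_⟩⟩, q, hq, by simp [hy']⟩
    have := ha.2.2 x (List.mem_of_getElem? hx) y List.mem_cons_self
    omega

theorem cons_append_mem_subdiagonalLists_iff {n i : ℕ} (hi : i ≤ n) {p q : List ℕ}
    (hp : p ∈ subdiagonalLists i) (hq : ∀ x ∈ q, 1 ≤ x) :
    1 :: (p ++ q.map (· + (i + 1))) ∈ subdiagonalLists (n + 1) ↔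
      q ∈ subdiagonalLists (n - i) := by
  have hpl := hp.1
  have hple := le_of_mem_subdiagonalLists hp
  have h₁ : (1 :: (p ++ q.map (· + (i + 1)))).Pairwise (· ≤ ·) ↔ q.Pairwise (· ≤ ·) := by
    rw [List.pairwise_cons, pairwise_append_map_add (fun x hx => by have := hple x hx; omega) hq,
      and_iff_right hp.2.1, and_iff_right]
    intro x hx
    rcases List.mem_append.1 hx with hx | hx
    · exact (hple x hx).1
    · obtain ⟨y, hy, rfl⟩ := List.mem_map.1 hx
      omega
  have h₂ : (1 :: (p ++ q.map (· + (i + 1)))).length = n + 1 ↔ q.length = n - i := by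
    simp only [List.length_cons, List.length_append, List.length_map, hpl]
    omega
  simp only [subdiagonalLists, Set.mem_ofPred_eq, h₁, h₂]
  refine and_congr_right fun _ => and_congr_right fun _ => ⟨fun h j x hx => ?_, fun h j x hx => ?_⟩
  · have := h (i + 1 + j) (x + (i + 1)) (by
      rw [show i + 1 + j = i + j + 1 by omega, List.getElem?_cons_succ, List.getElem?_append_right
        (by omega), hpl, Nat.add_sub_cancel_left, List.getElem?_map, hx, Option.map_some])
    have := hq x (List.mem_of_getElem? hx)
    omega
  · rcases j with _ | j
    · simp only [List.getElem?_cons_zero, Option.some.injEq] at hx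
      omega
    · rw [List.getElem?_cons_succ, List.getElem?_append] at hx
      split_ifs at hx with hj
      · have := hp.2.2 j x hx
        omega
      · rw [List.getElem?_map, Option.map_eq_some_iff] at hx
        obtain ⟨y, hy, rfl⟩ := hx
        have := h _ _ hy
        omega

/-- The first entry is forced to be 1; cutting the rest where it first exceeds the diagonal yields
the Catalan convolution. -/
theorem ncard_subdiagonalLists (t : ℕ) : (subdiagonalLists t).ncard = catalan t := by
  induction t using Nat.strong_induction_on with
  | _ t ih =>
  rcases t with _ | n
  · have : subdiagonalLists 0 = {[]} := by
      ext p
      simp only [subdiagonalLists, Set.mem_ofPred_eq, List.length_eq_zero_iff,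
        Set.mem_singleton_iff]
      refine and_iff_left_of_imp ?_
      rintro rfl
      simp
    rw [this, Set.ncard_singleton, catalan_zero]
  · have hhead : ∀ a ∈ subdiagonalLists (n + 1), a.head? = some 1 := by
      rintro a ⟨hl, -, ha⟩
      cases a with
      | nil => simp at hl
      | cons x l =>
        have := ha 0 x rfl
        simp only [List.head?_cons, Option.some.injEq]
        omega
    rw [← ncard_setOf_cons_mem hhead, catalan_succ, ncard_eq_sum_of_split (N := n)
      (P := subdiagonalLists) (Q := fun i => subdiagonalLists (n - i)) (d := fun i => i + 1)
      (fun j x => x ≤ j + 1) subdiagonalLists_finite (fun i => subdiagonalLists_finite _)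
      (fun i p hp => hp.1) (fun i p hp j x hx => (hp.2.2 j x hx).2), Finset.sum_range]
    · refine Finset.sum_congr rfl fun i _ => ?_
      rw [ih _ (by omega), ih _ (by omega)]
    · intro i q hq y hy
      have := hq.2.2 0 y hy
      omega
    · intro i hi p hp q hq
      exact (cons_append_mem_subdiagonalLists_iff hi hp
        fun x hx => (le_of_mem_subdiagonalLists hq x hx).1).2 hq
    · intro b hb
      obtain ⟨i, p, hp, q, hq, rfl⟩ := exists_subdiagonalLists_append
        (List.pairwise_cons.1 hb.2.1).2
        (fun x hx => (le_of_mem_subdiagonalLists hb x (List.mem_cons_of_mem _ hx)).1)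
      have hi : i ≤ n := by
        have h₁ := hb.1
        have h₂ := hp.1
        simp only [List.length_cons, List.length_append] at h₁
        omega
      exact ⟨i, hi, p, hp, q, (cons_append_mem_subdiagonalLists_iff hi hp hq).1 hb, rfl⟩

/-! ### Recurrences for ascending Naples parking functions -/

/-- Subdiagonal preferences after a first car in spot `1` fill an initial block. -/
theorem cons_append_mem_ascendingNaplesFromOne_iff {n k i : ℕ} (hi : i ≤ n) {p q : List ℕ}
    (hp : p ∈ subdiagonalLists i) (hq : ∀ x ∈ q, 1 ≤ x) :
    1 :: (p ++ q.map (· + (i + 1))) ∈ ascendingNaplesFromOne (n + 1) k ↔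
      q ∈ ascendingNaples (n - i) k := by
  have hpl := hp.1
  have hple := le_of_mem_subdiagonalLists hp
  have h₁ : (1 :: (p ++ q.map (· + (i + 1)))).Pairwise (· ≤ ·) ↔ q.Pairwise (· ≤ ·) := by
    rw [List.pairwise_cons, pairwise_append_map_add (fun x hx => by have := hple x hx; omega) hq,
      and_iff_right hp.2.1, and_iff_right]
    intro x hx
    rcases List.mem_append.1 hx with hx | hx
    · exact (hple x hx).1
    · obtain ⟨y, hy, rfl⟩ := List.mem_map.1 hx
      omega
  have h₂ : (1 :: (p ++ q.map (· + (i + 1)))).length = n + 1 ↔ q.length = n - i := by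
    simp only [List.length_cons, List.length_append, List.length_map, hpl]
    omega
  have h₃ : (∀ x ∈ 1 :: (p ++ q.map (· + (i + 1))), 1 ≤ x ∧ x ≤ n + 1) ↔
      ∀ x ∈ q, 1 ≤ x ∧ x ≤ n - i := by
    constructor
    · intro h x hx
      have := h (x + (i + 1))
        (List.mem_cons_of_mem _ (List.mem_append_right _ (List.mem_map_of_mem hx)))
      have := hq x hx
      omega
    · intro h x hx
      rcases List.mem_cons.1 hx with rfl | hx
      · omega
      rcases List.mem_append.1 hx with hx | hx
      · have := hple x hx
        omega
      · obtain ⟨y, hy, rfl⟩ := List.mem_map.1 hx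
        have := h y hy
        omega
  have h₄ : (parkCars (n + 1) k ∅ (1 :: (p ++ q.map (· + (i + 1))))).isSome =
      (parkCars (n - i) k ∅ q).isSome := by
    rw [parkCars_one_cons, parkCars_append, parkCars_Icc (by omega), Option.bind_some, hpl,
      show n + 1 = n - i + (i + 1) by omega]
    · refine isSome_parkCars_add _ _ _ _ hq _ _ ?_ ?_
      · intro x hx
        simp only [Finset.mem_Icc, Finset.notMem_empty, iff_false]
        omega
      · intro x hx hx'
        rw [Finset.mem_Icc]
        omega
    · intro j x hx
      have := hp.2.2 j x hx
      omega
  simp only [ascendingNaplesFromOne, ascendingNaples, IsNaplesParkingFunction,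
    IsParkingPreference, Set.mem_ofPred_eq, h₁, h₂, h₃, h₄, List.head?_cons, and_true]

theorem numAscendingFromOne_succ (n k : ℕ) :
    numAscendingFromOne (n + 1) k =
      ∑ i ∈ Finset.range (n + 1), catalan i * numAscending (n - i) k := by
  rw [numAscendingFromOne, ← ncard_setOf_cons_mem (fun a ha => ha.2),
    ncard_eq_sum_of_split (N := n) (P := subdiagonalLists)
      (Q := fun i => ascendingNaples (n - i) k) (d := fun i => i + 1) (fun j x => x ≤ j + 1)
      subdiagonalLists_finite (fun i => ascendingNaples_finite _ _) (fun i p hp => hp.1)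
      (fun i p hp j x hx => (hp.2.2 j x hx).2)]
  · simp only [ncard_subdiagonalLists, numAscending]
  · intro i q hq y hy
    have := hq.1.1.2 y (List.mem_of_getElem? hy)
    omega
  · intro i hi p hp q hq
    exact (cons_append_mem_ascendingNaplesFromOne_iff hi hp fun x hx => (hq.1.1.2 x hx).1).2 hq
  · intro b hb
    obtain ⟨i, p, hp, q, hq, rfl⟩ := exists_subdiagonalLists_append
      (List.pairwise_cons.1 hb.1.2).2 (fun x hx => (hb.1.1.1.2 x (List.mem_cons_of_mem _ hx)).1)
    have hi : i ≤ n := by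
      have h₁ := hb.1.1.1.1
      have h₂ := hp.1
      simp only [List.length_cons, List.length_append] at h₁
      omega
    exact ⟨i, hi, p, hp, q, (cons_append_mem_ascendingNaplesFromOne_iff hi hp hq).1 hb, rfl⟩

/-- Superdiagonal preferences up to the first return to the diagonal fill an initial block by
backward moves. -/
theorem append_mem_ascendingNaples_iff {n k i : ℕ} (hi : i < n) (hik : i ≤ k) {p q : List ℕ}
    (hp : p ∈ superdiagonalLists i) (hq : ∀ x ∈ q, 1 ≤ x) :
    p ++ (1 :: q).map (· + i) ∈ ascendingNaples n k ↔
      1 :: q ∈ ascendingNaplesFromOne (n - i) k := by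
  have hpl := hp.1
  have hple := le_of_mem_superdiagonalLists hp
  have hq' : ∀ x ∈ 1 :: q, 1 ≤ x := by simpa using hq
  have h₁ : (p ++ (1 :: q).map (· + i)).Pairwise (· ≤ ·) ↔ (1 :: q).Pairwise (· ≤ ·) := by
    rw [pairwise_append_map_add (fun x hx => (hple x hx).2) hq', and_iff_right hp.2.1]
  have h₂ : (p ++ (1 :: q).map (· + i)).length = n ↔ (1 :: q).length = n - i := by
    simp only [List.length_cons, List.length_append, List.length_map, hpl]
    omega
  have h₃ : (∀ x ∈ p ++ (1 :: q).map (· + i), 1 ≤ x ∧ x ≤ n) ↔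
      ∀ x ∈ 1 :: q, 1 ≤ x ∧ x ≤ n - i := by
    constructor
    · intro h x hx
      have := h (x + i) (List.mem_append_right _ (List.mem_map_of_mem hx))
      have := hq' x hx
      omega
    · intro h x hx
      rcases List.mem_append.1 hx with hx | hx
      · have := hple x hx
        omega
      · obtain ⟨y, hy, rfl⟩ := List.mem_map.1 hx
        have := h y hy
        omega
  -- Which car takes which spot is irrelevant: `i + 1` cars confined to `i + 1` spots fill them all.
  have hblock : parkCars n k ∅ (p ++ [1 + i]) = some (Finset.Icc 1 (i + 1)) := by
    obtain ⟨S, hS, hsub⟩ := exists_parkCars_of_le (n := n) (k := k) (t := i + 1)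
      (l := p ++ [1 + i]) (occ := ∅) (by omega) (Finset.empty_subset _) (by
        intro j x hx
        rw [List.getElem?_append] at hx
        rw [Finset.card_empty]
        split_ifs at hx with hj
        · have := hp.2.2 j x hx
          omega
        · obtain ⟨h, rfl⟩ := List.getElem?_eq_some_iff.1 hx
          simp only [List.length_singleton] at h
          simp only [List.getElem_singleton]
          omega)
    rw [hS, Finset.eq_of_subset_of_card_le hsub]
    rw [card_of_parkCars hS]
    simp [hpl]
  have h₄ : (parkCars n k ∅ (p ++ (1 :: q).map (· + i))).isSome =
      (parkCars (n - i) k ∅ (1 :: q)).isSome := by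
    rw [List.map_cons, List.append_cons, parkCars_append, hblock, Option.bind_some,
      parkCars_one_cons]
    conv_lhs => rw [show n = n - i + i by omega]
    refine isSome_parkCars_add _ _ _ _ hq _ _ ?_ ?_ <;> intro x <;>
      simp only [Finset.mem_Icc] <;> omega
  simp only [ascendingNaplesFromOne, ascendingNaples, IsNaplesParkingFunction,
    IsParkingPreference, Set.mem_ofPred_eq, h₁, h₂, h₃, h₄, List.head?_cons, and_true]

/-- If the first `k + 1` preferences exceed the diagonal, then spot `1` is never reached. -/
theorem length_le_of_append_mem_ascendingNaples {n k i : ℕ} {p r : List ℕ}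
    (hp : p ∈ superdiagonalLists i) (hr : r ≠ []) (h : p ++ r ∈ ascendingNaples n k) : i ≤ k := by
  by_contra! hki
  obtain ⟨⟨⟨hl, hle⟩, hpark⟩, hs⟩ := h
  obtain ⟨S, hS⟩ := Option.isSome_iff_exists.1 hpark
  have hr := List.length_pos_of_ne_nil hr
  rw [List.length_append, hp.1] at hl
  have hone : 1 ∉ S := by
    refine one_notMem_of_parkCars (Finset.notMem_empty 1) ?_ hS
    intro j x hx
    rw [Finset.card_empty]
    by_cases hj : j ≤ k
    · rw [List.getElem?_append_left (by rw [hp.1]; omega)] at hx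
      have := hp.2.2 j x hx
      omega
    -- Past position `k`, monotonicity keeps the entries at least as large as the one at `k`, which
    -- is at least `k + 2`.
    · right
      obtain ⟨hj', rfl⟩ := List.getElem?_eq_some_iff.1 hx
      have h₁ := List.pairwise_iff_getElem.1 hs k j (by omega) hj' (by omega)
      have h₂ := hp.2.2 k _ (List.getElem?_eq_getElem (by rw [hp.1]; omega))
      rw [List.getElem_append_left (by rw [hp.1]; omega)] at h₁
      omega
  have hcard := card_of_parkCars hS
  have hfull : S = Finset.Icc 1 n := by
    refine Finset.eq_of_subset_of_card_le
      (subset_Icc_of_parkCars hle (Finset.empty_subset _) hS) ?_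
    rw [hcard, Nat.card_Icc, List.length_append, hp.1, Finset.card_empty]
    omega
  refine hone ?_
  rw [hfull, Finset.mem_Icc]
  omega

theorem numAscendingFromOne_zero (k : ℕ) : numAscendingFromOne 0 k = 0 := by
  have : ascendingNaplesFromOne 0 k = ∅ := by
    refine Set.eq_empty_of_forall_notMem ?_
    rintro a ⟨⟨⟨⟨hl, -⟩, -⟩, -⟩, h⟩
    rw [List.length_eq_zero_iff] at hl
    simp [hl] at h
  rw [numAscendingFromOne, this, Set.ncard_empty]

theorem numAscending_zero (k : ℕ) : numAscending 0 k = 1 := by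
  have : ascendingNaples 0 k = {[]} := by
    ext a
    simp only [ascendingNaples, IsNaplesParkingFunction, IsParkingPreference,
      Set.mem_ofPred_eq, Set.mem_singleton_iff, List.length_eq_zero_iff]
    constructor
    · exact fun h => h.1.1.1
    · rintro rfl
      simp [parkCars]
  rw [numAscending, this, Set.ncard_singleton]

/-- A nonempty list must return to the diagonal, whence `n ≠ 0`. The term `i = n` vanishes and is
kept to match a Cauchy product. -/
theorem numAscending_eq_sum {n : ℕ} (hn : n ≠ 0) (k : ℕ) :
    numAscending n k = ∑ i ∈ Finset.range (n + 1),
      (if i ≤ k then catalan i else 0) * numAscendingFromOne (n - i) k := by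
  rw [numAscending, ncard_eq_sum_of_split (N := n)
      (P := fun i => {p | i ≤ k ∧ p ∈ superdiagonalLists i})
      (Q := fun i => ascendingNaplesFromOne (n - i) k) (d := fun i => i) (fun j x => j + 2 ≤ x)
      (fun i => (superdiagonalLists_finite i).subset fun p hp => hp.2)
      (fun i => (ascendingNaples_finite _ _).subset fun p hp => hp.1) (fun i p hp => hp.2.1)
      (fun i p hp j x hx => (hp.2.2.2 j x hx).1)]
  · refine Finset.sum_congr rfl fun i _ => congrArg₂ _ ?_ rfl
    by_cases hi : i ≤ k
    · simp [hi, ncard_superdiagonalLists, ncard_subdiagonalLists]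
    · simp [hi]
  · intro i q hq y hy
    have h := hq.2
    rw [List.head?_eq_getElem?, hy, Option.some.injEq] at h
    omega
  · rintro i - p ⟨hik, hp⟩ q hq
    have hle := hq.1.1.1.2
    obtain ⟨q, rfl⟩ := List.head?_eq_some_iff.1 hq.2
    have := hle 1 List.mem_cons_self
    exact (append_mem_ascendingNaples_iff (by omega) hik hp
      fun x hx => (hle x (List.mem_cons_of_mem _ hx)).1).2 hq
  · intro a ha
    have hl := ha.1.1.1
    obtain ⟨i, p, hp, q, hq, rfl⟩ := exists_superdiagonalLists_append ha.2 (hl ▸ ha.1.1.2)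
      (by rintro rfl; exact hn hl.symm)
    have hi : i < n := by
      simp only [List.length_append, List.length_map, List.length_cons, hp.1] at hl
      omega
    have hik := length_le_of_append_mem_ascendingNaples hp (by simp) ha
    exact ⟨i, hi.le, p, ⟨hik, hp⟩, 1 :: q,
      (append_mem_ascendingNaples_iff hi hik hp hq).1 ha, rfl⟩

/-! ### Generating functions -/

/-- The generating function of the first `k + 1` Catalan numbers. -/
noncomputable def genCatalanUpTo (k : ℕ) : PowerSeries ℤ :=
  PowerSeries.mk fun n => if n ≤ k then (catalan n : ℤ) else 0

theorem genU_eq (k : ℕ) :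
    genU k = PowerSeries.X * (PowerSeries.mk (fun n => (catalan n : ℤ)) * genI k) := by
  ext n
  rcases n with _ | n
  · simp [genU, numAscendingFromOne_zero]
  · rw [PowerSeries.coeff_succ_X_mul, PowerSeries.coeff_mul,
      Finset.Nat.sum_antidiagonal_eq_sum_range_succ_mk]
    simp only [genU, genI, PowerSeries.coeff_mk, numAscendingFromOne_succ]
    push_cast
    rfl

theorem genI_eq (k : ℕ) : genI k = 1 + genCatalanUpTo k * genU k := by
  ext n
  rw [map_add, PowerSeries.coeff_mul, Finset.Nat.sum_antidiagonal_eq_sum_range_succ_mk]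
  simp only [genU, genI, genCatalanUpTo, PowerSeries.coeff_mk, PowerSeries.coeff_one]
  rcases eq_or_ne n 0 with rfl | hn
  · simp [numAscending_zero, numAscendingFromOne_zero]
  · rw [if_neg hn, zero_add, numAscending_eq_sum hn]
    push_cast
    rfl

theorem genCatalanUpTo_succ (k : ℕ) :
    genCatalanUpTo (k + 1) =
      genCatalanUpTo k + PowerSeries.C (catalan (k + 1) : ℤ) * PowerSeries.X ^ (k + 1) := by
  ext n
  simp only [genCatalanUpTo, map_add, PowerSeries.coeff_mk, PowerSeries.coeff_C_mul,
    PowerSeries.coeff_X_pow]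
  rcases lt_trichotomy n (k + 1) with h | rfl | h
  · simp [h.le, h.ne, Nat.lt_succ_iff.1 h]
  · simp
  · simp [h.not_ge, h.ne', (Nat.lt_of_succ_lt h).not_ge]

theorem theorem5p6 (k : ℕ) (hk : 1 ≤ k) :
    genI k = genI (k - 1)
        + PowerSeries.C (catalan k : ℤ) * PowerSeries.X ^ k * genI (k - 1) * genU k ∧
    genU k = genU (k - 1)
        + PowerSeries.C (catalan k : ℤ) * PowerSeries.X ^ k * genU (k - 1) * genU k := by
  obtain ⟨k, rfl⟩ := Nat.exists_eq_add_of_le' hk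
  rw [Nat.add_sub_cancel]
  have hI₀ := genI_eq k
  have hI₁ := genI_eq (k + 1)
  have hU₀ := genU_eq k
  have hU₁ := genU_eq (k + 1)
  rw [genCatalanUpTo_succ] at hI₁
  set A := genCatalanUpTo k
  set Y := PowerSeries.C (catalan (k + 1) : ℤ) * PowerSeries.X ^ (k + 1)
  set K := PowerSeries.mk (fun n => (catalan n : ℤ))
  -- Cross-multiplying the equations for `genI` cancels the product of the two series; by `hU₀` and
  -- `hU₁` the terms with `A` cancel as well.
  have hI : genI (k + 1) = genI k + Y * genI k * genU (k + 1) := by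
    linear_combination genI k * hI₁ - genI (k + 1) * hI₀
      + genI k * A * hU₁ - genI (k + 1) * A * hU₀
  refine ⟨hI, ?_⟩
  rw [hU₀]
  -- Multiplying `hI` by `X * K` turns each outer `genI` into `genU`.
  linear_combination hU₁ + PowerSeries.X * K * hI
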